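/- Consider the advection equation $u_t+u_x=0$ on $[0,1]$ with periodic boundary condition, the grid $x_j=jh$, $h=1/N$, and the hybrid-variable (HV) semi-discretization for cell averages $\bar u_{j+1/2}$ and nodal values $u_j$ (indices modulo $N$), $$\bar u_{j+1/2}'+\tfrac1h(u_{j+1}-u_j)=0,\qquad u_j'+[\mathcal D_xu]_j=0,\qquad [\mathcal D_xu]_j=\frac1h\sum_{k=-l}^{r-1}\alpha_k\bar u_{j+k+1/2}+\frac1h\sum_{k=-l'}^{r'}\beta_ku_{j+k},$$ with real coefficients and a contiguous stencil of nonnegative integers, $l'\le l\le l'+1$ and $r'\le r\le r'+1$; put $L=l+l'$ and $R=r+r'$. Assume that $\mathcal D_x$ has the optimal order of accuracy $p=L+R$, i.e. there is $c_p\neq0$ such that for every smooth $u$, applying $\mathcal D_x$ to exact cell averages and nodal values gives $u'(x_j)+c_pu^{(p+1)}(x_j)h^p+O(h^{p+1})$ as $h\to0^+$. Let $G(\theta)=\sum_{k=-l}^{r-1}\alpha_ke^{ik\theta}$, $H(\theta)=\sum_{k=-l'}^{r'}\beta_ke^{ik\theta}$ and $F(\theta)=(e^{i\theta}-1)G(\theta)$.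 **Theorem 2.** If $4\le L-R\le7$, the semi-discretized HV method is unstable. More precisely, $\operatorname{Re}H(\pi)<0$; the set $\{\lambda\in\mathbb C:\lambda^2-H(\theta)\lambda-F(\theta)=0\text{ for some }0<\theta<2\pi\}$ is not contained in the open right half plane $\{\operatorname{Re}z>0\}$; and for every even $N\ge2$ the system of ordinary differential equations above is not stable, where stable means that all its eigenvalues have negative real part except at most a simple one at zero. -/

import Mathlib

namespace HV

/-- A stencil of an operator at the node `x_j`: `l` cells and `l'` nodes to the left of `x_j`,
`r` cells and `r'` nodes to the right of `x_j` (the node `x_j` itself is always used). -/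
structure Stencil where
  l : ℕ
  r : ℕ
  l' : ℕ
  r' : ℕ

namespace Stencil

/-- The stencil uses a contiguous set of cells and nodes. -/
def IsContiguous (s : Stencil) : Prop :=
  (s.l' ≤ s.l ∧ s.l ≤ s.l' + 1) ∧ (s.r' ≤ s.r ∧ s.r ≤ s.r' + 1)

/-- `L = l + l'`: the number of upwind entities. -/
def L (s : Stencil) : ℕ := s.l + s.l'

/-- `R = r + r'`: the number of downwind entities. -/
def R (s : Stencil) : ℕ := s.r + s.r'

end Stencil

/-- A discrete differential operator on the stencil `s`, given by its coefficients. Only `α k` with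
`-l ≤ k ≤ r - 1` and `β k` with `-l' ≤ k ≤ r'` are ever used. -/
structure DDO (s : Stencil) where
  α : ℤ → ℝ
  β : ℤ → ℝ

namespace DDO

variable {s : Stencil}

/-- The operator with grid size `h`, applied at the node `x` to the exact cell averages
`(1/h) ∫_{x+kh}^{x+(k+1)h} u` and the exact nodal values `u (x + k h)` of a function `u`. -/
noncomputable def applyExact (D : DDO s) (h : ℝ) (u : ℝ → ℝ) (x : ℝ) : ℝ :=
  (1 / h) * ∑ k ∈ Finset.Ico (-(s.l : ℤ)) (s.r : ℤ),
      D.α k * ((1 / h) * ∫ y in (x + k * h)..(x + (k + 1) * h), u y)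
    + (1 / h) * ∑ k ∈ Finset.Icc (-(s.l' : ℤ)) (s.r' : ℤ), D.β k * u (x + k * h)

/-- `D` is accurate of order `p`: for some `c ≠ 0` and every smooth `u`,
`[D u](x) = u'(x) + c h ^ p u⁽ᵖ⁺¹⁾(x) + O(h ^ (p + 1))` as `h → 0+`. -/
def HasOrder (D : DDO s) (p : ℕ) : Prop :=
  ∃ c : ℝ, c ≠ 0 ∧ ∀ u : ℝ → ℝ, ContDiff ℝ ((⊤ : ℕ∞) : WithTop ℕ∞) u → ∀ x : ℝ,
    (fun h : ℝ => D.applyExact h u x - (deriv u x + c * iteratedDeriv (p + 1) u x * h ^ p))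
      =O[nhdsWithin 0 (Set.Ioi 0)] fun h : ℝ => h ^ (p + 1)

/-- Optimal accuracy: order `l + r + l' + r' = L + R`. -/
def IsOptimal (D : DDO s) : Prop := D.HasOrder (s.L + s.R)

/-- The symbol `G(θ) = ∑ α_k e^{ikθ}` of the cell-average part. -/
noncomputable def G (D : DDO s) (θ : ℝ) : ℂ :=
  ∑ k ∈ Finset.Ico (-(s.l : ℤ)) (s.r : ℤ), (D.α k : ℂ) * Complex.exp (Complex.I * k * θ)

/-- The symbol `H(θ) = ∑ β_k e^{ikθ}` of the nodal part. -/
noncomputable def H (D : DDO s) (θ : ℝ) : ℂ :=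
  ∑ k ∈ Finset.Icc (-(s.l' : ℤ)) (s.r' : ℤ), (D.β k : ℂ) * Complex.exp (Complex.I * k * θ)

/-- `F(θ) = (e^{iθ} - 1) G(θ)`. -/
noncomputable def F (D : DDO s) (θ : ℝ) : ℂ :=
  (Complex.exp (Complex.I * θ) - 1) * D.G θ

/-- The roots `λ` of the characteristic equation `λ² - H(θ) λ - F(θ) = 0`, `0 < θ < 2π`. -/
def rootSet (D : DDO s) : Set ℂ :=
  {z : ℂ | ∃ θ : ℝ, 0 < θ ∧ θ < 2 * Real.pi ∧ z ^ 2 - D.H θ * z - D.F θ = 0}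

/-- Stability in von Neumann form: all these roots lie in the open right half plane. -/
def IsVonNeumannStable (D : DDO s) : Prop := D.rootSet ⊆ {z : ℂ | 0 < z.re}

/-- The semi-discretization of `u_t + u_x = 0` on `[0, 1]` with periodic boundary condition and
`N` cells, `h = 1 / N`, is the linear system `v' = A v` with this `A`. The state is `v = (ū, u)`;
`v.1 j` is the average over the cell `[x_j, x_{j+1}]`, `v.2 j` is the value at the node `x_j`:
`ū_{j+1/2}' = -(1/h) (u_{j+1} - u_j)` and `u_j' = -[D u]_j`. -/
noncomputable def semiDiscrete (D : DDO s) (N : ℕ) :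
    Module.End ℂ ((ZMod N → ℂ) × (ZMod N → ℂ)) where
  toFun v :=
    let h : ℂ := 1 / N
    (fun j => -((1 / h) * (v.2 (j + 1) - v.2 j)),
     fun j => -((1 / h) * ∑ k ∈ Finset.Ico (-(s.l : ℤ)) (s.r : ℤ), (D.α k : ℂ) * v.1 (j + k)
        + (1 / h) * ∑ k ∈ Finset.Icc (-(s.l' : ℤ)) (s.r' : ℤ), (D.β k : ℂ) * v.2 (j + k)))
  map_add' v w := by
    ext j
    · simp only [Prod.snd_add, Pi.add_apply, Prod.mk_add_mk]
      ring
    · simp only [Prod.fst_add, Prod.snd_add, Pi.add_apply, mul_add, Finset.sum_add_distrib,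
        Prod.mk_add_mk]
      ring
  map_smul' c v := by
    ext j
    · simp only [Prod.smul_snd, Pi.smul_apply, smul_eq_mul, RingHom.id_apply, Prod.smul_mk]
      ring
    · simp only [Prod.smul_fst, Prod.smul_snd, Pi.smul_apply, smul_eq_mul, RingHom.id_apply,
        Prod.smul_mk, mul_left_comm _ c, ← Finset.mul_sum]
      ring

/-- The semi-discretized system with `N` cells is stable: all its eigenvalues have negative real
part, except at most a simple one at zero. -/
def IsStableWith (D : DDO s) (N : ℕ) : Prop :=
  ∀ μ : ℂ, (D.semiDiscrete N).HasEigenvalue μ →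
    μ.re < 0 ∨ (μ = 0 ∧ Module.finrank ℂ ((D.semiDiscrete N).maxGenEigenspace 0) = 1)

end DDO

end HV

/-! At `θ = π` the two roots of the characteristic equation sum to `H(π) = ∑ β_k (-1)^k`, so once
this real number is negative one root `z` has negative real part, and the alternating grid function
turns it into an eigenvalue `-N z` in the right half plane. Everything rests on the sign of that
alternating sum.

Its exact value comes from one test polynomial. An operator of order `p` differentiates polynomials
of degree at most `p` exactly. Take `U = X q V`, where `X q` vanishes at all cell end points; then
all cell averages of `U'` vanish. At a node, `(X q)'(k)` is a constant times `(-1)^k / C(l + r, l +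
k)`, and `V` interpolates those binomial coefficients, so `U'(k)` is a constant times `(-1)^k`.
Exactness gives `∑ β_k (-1)^k` as a multiple of `U''(0)`, hence as explicit binomial sums
(`alternating_sum`).

The sign of these sums is read off an integral. Up to a positive factor they equal the integral over
`0 ≤ ψ ≤ φ ≤ π` of `(2 cos(φ/2))^(l+r) (2 sin(ψ/2))^(l'+r')` times a sine
(`integral_integral_sum_shiftedChoose`, `sum_sum_shiftedChoose_mul_sin`). The kernel changes sign,
but after `φ = π - u - v`, `ψ = u - v` and folding `v ↦ -v` it becomes `(cos v - cos u)^n sin u`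
times a polynomial in `cos u`, `cos v`. The `u`-integral is then elementary, and for `4 ≤ L - R ≤ 7`
it is negative for each `v` (`integral_triangle_neg` and the eight kernel lemmas). -/

/-! ### Order of accuracy as exactness on polynomials -/

section

open Filter Topology MeasureTheory intervalIntegral

/-- If `h ^ m * B = O(h ^ n)` as `h → 0+` with `m < n`, then the constant `B` vanishes. -/
theorem eq_zero_of_pow_mul_isBigO {B : ℝ} {m n : ℕ} (hmn : m < n)
    (h : (fun h : ℝ => h ^ m * B) =O[𝓝[>] (0 : ℝ)] fun h : ℝ => h ^ n) : B = 0 := by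
  have h1 : (fun _ : ℝ => B) =O[𝓝[>] (0 : ℝ)] fun h : ℝ => h ^ (n - m) := by
    have h2 := (Asymptotics.isBigO_refl (fun h : ℝ => (h ^ m)⁻¹) (𝓝[>] (0 : ℝ))).mul h
    refine (h2.congr' ?_ ?_)
    · filter_upwards [self_mem_nhdsWithin] with x hx
      have : x ≠ 0 := ne_of_gt hx
      field_simp
    · filter_upwards [self_mem_nhdsWithin] with x hx
      have : x ≠ 0 := ne_of_gt hx
      have e : x ^ n = x ^ m * x ^ (n - m) := by rw [← pow_add]; congr 1; omega
      rw [e]; field_simp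
  have h3 : Tendsto (fun h : ℝ => h ^ (n - m)) (𝓝[>] (0 : ℝ)) (𝓝 0) := by
    have : Tendsto (fun h : ℝ => h ^ (n - m)) (𝓝 (0 : ℝ)) (𝓝 (0 ^ (n - m))) :=
      (continuous_pow _).tendsto 0
    rw [zero_pow (by omega)] at this
    exact this.mono_left nhdsWithin_le_nhds
  exact tendsto_nhds_unique tendsto_const_nhds (h1.trans_tendsto h3)

theorem integral_pow_scaled (h a b : ℝ) (m : ℕ) :
    ∫ y in (a * h)..(b * h), y ^ m = h ^ (m + 1) * ∫ y in a..b, y ^ m := by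
  rw [integral_pow, integral_pow]; ring

namespace HV.DDO

variable {s : Stencil}

/-- The functional obtained from the operator `D` with `h = 1` at the node `0`. -/
noncomputable def functional (D : DDO s) (u : ℝ → ℝ) : ℝ :=
  ∑ k ∈ Finset.Ico (-(s.l : ℤ)) (s.r : ℤ), D.α k * (∫ y in (k : ℝ)..(k + 1), u y)
    + ∑ k ∈ Finset.Icc (-(s.l' : ℤ)) (s.r' : ℤ), D.β k * u k

theorem applyExact_pow (D : DDO s) {h : ℝ} (hh : h ≠ 0) (m : ℕ) :
    h * D.applyExact h (fun y => y ^ m) 0 = h ^ m * D.functional fun y => y ^ m := by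
  simp only [applyExact, functional, zero_add]
  simp only [integral_pow_scaled, mul_pow]
  simp only [mul_add, Finset.mul_sum]
  congr 1 <;> refine Finset.sum_congr rfl fun k _ => ?_ <;> field_simp
  ring

/-- At the node `0` a monomial makes everything homogeneous in `h`: `h` times the error is `h ^ m`
times a constant, the `c` term drops out because `m ≤ p`, and the remainder is `O(h ^ (p + 2))`. The
constant must therefore vanish. -/
theorem HasOrder.functional_pow {D : DDO s} {p : ℕ} (hD : D.HasOrder p) {m : ℕ} (hm : m ≤ p) :
    D.functional (fun y => y ^ m) = if m = 1 then 1 else 0 := by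
  obtain ⟨c, -, hc⟩ := hD
  have h1 := hc (fun y => y ^ m) (contDiff_id.pow m) 0
  have h2 : deriv (fun y : ℝ => y ^ m) 0 = if m = 1 then 1 else 0 := by
    rcases m with _ | _ | m <;> simp
  have h3 : iteratedDeriv (p + 1) (fun y : ℝ => y ^ m) 0 = 0 := by
    rw [iteratedDeriv_fun_pow_zero, if_neg (by omega), Nat.cast_zero]
  rw [h2, h3] at h1
  refine sub_eq_zero.1 (eq_zero_of_pow_mul_isBigO (m := m) (n := p + 2) (by omega) ?_)
  refine ((Asymptotics.isBigO_refl (fun h : ℝ => h) (𝓝[>] (0 : ℝ))).mul h1).congr' ?_ ?_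
  · filter_upwards [self_mem_nhdsWithin] with h hh
    have := D.applyExact_pow (ne_of_gt hh : h ≠ 0) m
    rw [mul_sub, this]
    by_cases hm1 : m = 1
    · subst hm1; simp; ring
    · simp [hm1]
  · filter_upwards with h using by ring

theorem functional_finset_sum (D : DDO s) {ι : Type*} (t : Finset ι) (c : ι → ℝ)
    (f : ι → ℝ → ℝ) (hf : ∀ i ∈ t, Continuous (f i)) :
    D.functional (fun y => ∑ i ∈ t, c i * f i y) = ∑ i ∈ t, c i * D.functional (f i) := by
  have key : ∀ a b : ℝ, ∫ y in a..b, ∑ i ∈ t, c i * f i y = ∑ i ∈ t, c i * ∫ y in a..b, f i y := by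
    intro a b
    rw [intervalIntegral.integral_finsetSum]
    · simp
    · exact fun i hi => ((hf i hi).const_smul (c i)).intervalIntegrable _ _
  simp only [functional, key, mul_add, Finset.sum_add_distrib, Finset.mul_sum]
  congr 1 <;> rw [Finset.sum_comm] <;>
    exact Finset.sum_congr rfl fun _ _ => Finset.sum_congr rfl fun _ _ => by ring

open Polynomial in
/-- An operator of order `p` differentiates polynomials of degree at most `p` exactly. -/
theorem HasOrder.functional_polynomial {D : DDO s} {p : ℕ} (hD : D.HasOrder p) {P : ℝ[X]}
    (hP : P.natDegree ≤ p) : D.functional (fun y => P.eval y) = P.derivative.eval 0 := by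
  have h1 : (fun y => P.eval y) = fun y => ∑ i ∈ Finset.range (p + 1), P.coeff i * y ^ i := by
    funext y
    exact eval_eq_sum_range' (by omega) y
  rw [h1, functional_finset_sum D _ _ _ fun i _ => continuous_pow i]
  rw [Finset.sum_congr rfl fun i hi => by
    rw [hD.functional_pow (Nat.lt_succ_iff.1 (Finset.mem_range.1 hi))]]
  rw [← coeff_zero_eq_eval_zero, coeff_derivative]
  -- For `p = 0` the sum has no term `i = 1`, but then `P` is constant.
  rcases p with _ | p
  · simp [coeff_eq_zero_of_natDegree_lt (show P.natDegree < 1 by omega)]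
  · simp

open Polynomial in
/-- If a polynomial `U` takes the same value at all end points of the cells of the stencil, then an
exact operator recovers `U''(0)` from the nodal values of `U'` alone. -/
theorem HasOrder.sum_mul_derivative {D : DDO s} {p : ℕ} (hD : D.HasOrder p) {U : ℝ[X]}
    (hU : U.natDegree ≤ p + 1) (h0 : ∀ k ∈ Finset.Icc (-(s.l : ℤ)) (s.r : ℤ), U.eval (k : ℝ) = 0) :
    ∑ k ∈ Finset.Icc (-(s.l' : ℤ)) (s.r' : ℤ), D.β k * U.derivative.eval (k : ℝ) =
      U.derivative.derivative.eval 0 := by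
  rw [← hD.functional_polynomial ((natDegree_derivative_le U).trans (by omega)), functional,
    right_eq_add]
  refine Finset.sum_eq_zero fun k hk => ?_
  rw [Finset.mem_Ico] at hk
  rw [integral_eq_sub_of_hasDerivAt (f := fun y => U.eval y) (fun x _ => U.hasDerivAt x)
    (U.derivative.continuous.intervalIntegrable _ _), h0 k (Finset.mem_Icc.2 (by omega))]
  have := h0 (k + 1) (Finset.mem_Icc.2 (by omega))
  push_cast at this
  rw [this]; simp

end HV.DDO

end

/-! ### Finite differences, nodal polynomials and the alternating sum -/

section

open Polynomial

/-- Sums over an integer interval `[-l, r]` as sums over natural numbers. -/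
theorem sum_Icc_neg_eq_sum_range {M : Type*} [AddCommMonoid M] (l r : ℕ) (f : ℤ → M) :
    ∑ k ∈ Finset.Icc (-(l : ℤ)) r, f k = ∑ i ∈ Finset.range (l + r + 1), f (i - l) := by
  symm
  refine Finset.sum_bij (fun i _ => (i : ℤ) - l) ?_ ?_ ?_ ?_
  · intro i hi; simp only [Finset.mem_range, Finset.mem_Icc] at *; omega
  · intro i _ j _ h; omega
  · intro k hk
    simp only [Finset.mem_Icc] at hk
    exact ⟨(k + l).toNat, by simp; omega, by simp; omega⟩
  · intros; rfl

/-- The binomial coefficient `C(l + r, l + k)`, for `-l ≤ k ≤ r`. -/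
def shiftedChoose (l r : ℕ) (k : ℤ) : ℝ := ((l + r).choose (k + l).toNat : ℝ)

theorem shiftedChoose_sub (l r i : ℕ) : shiftedChoose l r (i - l) = (l + r).choose i := by
  simp [shiftedChoose]

theorem shiftedChoose_pos {l r : ℕ} {k : ℤ} (hk : k ∈ Finset.Icc (-(l : ℤ)) r) :
    0 < shiftedChoose l r k := by
  rw [Finset.mem_Icc] at hk
  exact Nat.cast_pos.2 (Nat.choose_pos (by omega))

theorem zero_mem_Icc_neg (l r : ℕ) : (0 : ℤ) ∈ Finset.Icc (-(l : ℤ)) r := by simp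

/-- The `(l + r)`-th finite difference annihilates polynomials of degree less than `l + r`. -/
theorem sum_shiftedChoose_mul_eval_eq_zero {l r : ℕ} {Q : ℝ[X]} (hQ : Q.natDegree < l + r) :
    ∑ k ∈ Finset.Icc (-(l : ℤ)) r, (-1) ^ k * shiftedChoose l r k * Q.eval (k : ℝ) = 0 := by
  have h := congrFun (fwdDiff_iter_eq_zero_of_degree_lt hQ) (-(l : ℝ))
  rw [fwdDiff_iter_eq_sum_shift] at h
  rw [sum_Icc_neg_eq_sum_range]
  have h2 : ∀ i ∈ Finset.range (l + r + 1),
      (-1 : ℝ) ^ ((i : ℤ) - l) * shiftedChoose l r (i - l) * Q.eval (((i - l : ℤ)) : ℝ) =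
      (-1) ^ r * (((-1 : ℤ) ^ (l + r - i) * (l + r).choose i) • Q.eval (-(l : ℝ) + i • 1)) := by
    intro i hi
    rw [Finset.mem_range] at hi
    have e : (-1 : ℝ) ^ ((i : ℤ) - l) = (-1) ^ r * (-1) ^ (l + r - i) := by
      rw [← zpow_natCast, ← zpow_natCast, ← zpow_add₀ (by norm_num),
        show ((r : ℤ) + ((l + r - i : ℕ) : ℤ)) = (i - l) + 2 * (l + r - i) by omega,
        zpow_add₀ (by norm_num), zpow_mul]
      norm_num
    rw [e, shiftedChoose_sub, zsmul_eq_mul]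
    push_cast
    rw [show (-(l : ℝ) + i • 1) = i - l by simp; ring]
    ring
  rw [Finset.sum_congr rfl h2, ← Finset.mul_sum, h]
  simp

/-- The derivative at `0` of a polynomial in terms of its values at the integers in `[-l, r]`. -/
theorem shiftedChoose_zero_mul_derivative {l r : ℕ} (hlr : 0 < l + r) {Q : ℝ[X]}
    (hQ : Q.natDegree ≤ l + r) :
    shiftedChoose l r 0 * Q.derivative.eval 0 =
      -∑ k ∈ (Finset.Icc (-(l : ℤ)) r).erase 0,
        (-1) ^ k * shiftedChoose l r k * ((Q.eval (k : ℝ) - Q.eval 0) / k) := by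
  -- The quotient `(Q - Q(0)) / X` has degree below `l + r`, so the finite difference kills it;
  -- isolating the term `k = 0` gives its value at `0`, which is `Q'(0)`.
  have h1 : (Q.divX).natDegree < l + r := by
    rw [natDegree_divX_eq_natDegree_tsub_one]; omega
  have h2 := sum_shiftedChoose_mul_eval_eq_zero h1
  rw [← Finset.add_sum_erase _ _ (zero_mem_Icc_neg l r)] at h2
  have h3 : Q.derivative.eval 0 = Q.divX.eval 0 := by
    rw [← coeff_zero_eq_eval_zero, ← coeff_zero_eq_eval_zero, coeff_derivative, coeff_divX]; simp
  have h4 : ∀ k ∈ (Finset.Icc (-(l : ℤ)) r).erase 0,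
      (-1 : ℝ) ^ k * shiftedChoose l r k * ((Q.eval (k : ℝ) - Q.eval 0) / k) =
      (-1) ^ k * shiftedChoose l r k * Q.divX.eval (k : ℝ) := by
    intro k hk
    have hk0 : (k : ℝ) ≠ 0 := by exact_mod_cast (Finset.mem_erase.1 hk).1
    congr 1
    conv_lhs => rw [← divX_mul_X_add Q]
    simp [hk0]
  rw [Finset.sum_congr rfl h4, h3]
  simp only [Int.cast_zero, zpow_zero, one_mul] at h2
  linarith

/-- The product of `X - k` over the nonzero integers `k` in `[-l, r]`. -/
noncomputable def puncturedNodal (l r : ℕ) : ℝ[X] :=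
  ∏ k ∈ (Finset.Icc (-(l : ℤ)) r).erase 0, (X - C (k : ℝ))

theorem natDegree_puncturedNodal (l r : ℕ) : (puncturedNodal l r).natDegree = l + r := by
  rw [puncturedNodal, natDegree_prod_of_monic _ _ fun k _ => monic_X_sub_C _]
  simp only [natDegree_X_sub_C, Finset.sum_const, Finset.card_erase_of_mem (zero_mem_Icc_neg l r),
    Int.card_Icc, smul_eq_mul]
  omega

theorem puncturedNodal_eval_eq_zero {l r : ℕ} {k : ℤ}
    (hk : k ∈ (Finset.Icc (-(l : ℤ)) r).erase 0) : (puncturedNodal l r).eval (k : ℝ) = 0 := by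
  rw [puncturedNodal, eval_prod]
  exact Finset.prod_eq_zero hk (by simp)

theorem puncturedNodal_eval_zero_ne_zero (l r : ℕ) : (puncturedNodal l r).eval 0 ≠ 0 := by
  rw [puncturedNodal, eval_prod]
  refine Finset.prod_ne_zero_iff.2 fun k hk => ?_
  have : (k : ℝ) ≠ 0 := by exact_mod_cast (Finset.mem_erase.1 hk).1
  simpa using this

/-- The derivatives of the nodal polynomial `X * puncturedNodal l r` at its zeros are inversely
proportional to alternating binomial coefficients. -/
theorem shiftedChoose_mul_eval_derivative_nodal {l r : ℕ} {k : ℤ}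
    (hk : k ∈ Finset.Icc (-(l : ℤ)) r) :
    (-1) ^ k * shiftedChoose l r k * (X * puncturedNodal l r).derivative.eval (k : ℝ) =
      shiftedChoose l r 0 * (puncturedNodal l r).eval 0 := by
  by_cases hk0 : k = 0
  · subst hk0; simp
  have hk' : k ∈ (Finset.Icc (-(l : ℤ)) r).erase 0 := Finset.mem_erase.2 ⟨hk0, hk⟩
  -- `T` omits the factors of both `0` and `k`. Only these two points survive in its vanishing
  -- finite difference, which ties `T(k)` to `T(0)`.
  set T : ℝ[X] := ∏ j ∈ ((Finset.Icc (-(l : ℤ)) r).erase 0).erase k, (X - C (j : ℝ)) with hT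
  have hqT : puncturedNodal l r = (X - C (k : ℝ)) * T := (Finset.mul_prod_erase _ _ hk').symm
  have hTdeg : T.natDegree < l + r := by
    have h1 := natDegree_puncturedNodal l r
    have hT0 : T ≠ 0 := Finset.prod_ne_zero_iff.2 fun j _ => X_sub_C_ne_zero _
    rw [hqT, natDegree_mul (X_sub_C_ne_zero _) hT0, natDegree_X_sub_C] at h1
    omega
  have h2 := sum_shiftedChoose_mul_eval_eq_zero hTdeg
  rw [← Finset.add_sum_erase _ _ (zero_mem_Icc_neg l r), ← Finset.add_sum_erase _ _ hk',
    Finset.sum_eq_zero (s := ((Finset.Icc (-(l : ℤ)) r).erase 0).erase k)] at h2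
  · simp at h2
    rw [hqT]
    simp
    linear_combination (k : ℝ) * h2
  · intro j hj
    rw [hT, eval_prod, Finset.prod_eq_zero hj (by simp), mul_zero]

/-- The alternating sum of the nodal coefficients of an optimal operator. -/
theorem HV.DDO.IsOptimal.alternating_sum {s : HV.Stencil} {D : HV.DDO s} (hD : D.IsOptimal)
    (hs : s.IsContiguous) (h' : 0 < s.l' + s.r') :
    shiftedChoose s.l s.r 0 * shiftedChoose s.l' s.r' 0 *
        ∑ k ∈ Finset.Icc (-(s.l' : ℤ)) s.r', D.β k * (-1) ^ k =
      2 * (shiftedChoose s.l' s.r' 0 *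
          ∑ k ∈ (Finset.Icc (-(s.l : ℤ)) s.r).erase 0, (-1) ^ k * shiftedChoose s.l s.r k / k) -
      2 * ∑ k ∈ (Finset.Icc (-(s.l' : ℤ)) s.r').erase 0, (-1) ^ k * shiftedChoose s.l' s.r' k *
          ((shiftedChoose s.l s.r k - shiftedChoose s.l s.r 0) / k) := by
  obtain ⟨l, r, l', r'⟩ := s
  simp only [HV.Stencil.IsContiguous] at *
  obtain ⟨⟨h1, -⟩, h2, -⟩ := hs
  have hlr : 0 < l + r := by omega
  have hsub : ∀ k ∈ Finset.Icc (-(l' : ℤ)) (r' : ℤ), k ∈ Finset.Icc (-(l : ℤ)) (r : ℤ) := by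
    intro k hk; simp only [Finset.mem_Icc] at *; omega
  set q := puncturedNodal l r with hq
  set c := shiftedChoose l r with hc
  set b := shiftedChoose l' r' with hb
  have hq0 : q.eval 0 ≠ 0 := puncturedNodal_eval_zero_ne_zero l r
  have hc0 : c 0 ≠ 0 := (shiftedChoose_pos (zero_mem_Icc_neg l r)).ne'
  -- `V(k) = c k` cancels the binomial coefficient in the denominator of `(X q)'(k)`, leaving a pure
  -- alternating sign.
  set V := Lagrange.interpolate (Finset.Icc (-(l' : ℤ)) r') (fun k : ℤ => (k : ℝ)) c with hV
  have hinj : Set.InjOn (fun k : ℤ => (k : ℝ)) (Finset.Icc (-(l' : ℤ)) (r' : ℤ)) :=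
    Int.cast_injective.injOn
  have hVk : ∀ k ∈ Finset.Icc (-(l' : ℤ)) (r' : ℤ), V.eval (k : ℝ) = c k := fun k hk =>
    Lagrange.eval_interpolate_at_node c hinj hk
  have hV0 : V.eval 0 = c 0 := by simpa using hVk 0 (zero_mem_Icc_neg l' r')
  have hVdeg : V.natDegree ≤ l' + r' := by
    have h3 := Lagrange.degree_interpolate_lt c hinj
    rw [← hV] at h3
    have h4 : V.degree < ((l' + r' + 1 : ℕ) : WithBot ℕ) := by
      convert h3 using 2
      simp
      omega
    by_cases hV : V = 0
    · simp [hV]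
    · exact Nat.lt_succ_iff.1 ((natDegree_lt_iff_degree_lt hV).2 h4)
  -- The degree of `X * q * V` is at most `1 + (l + r) + (l' + r') = p + 1`, just what optimal order
  -- permits.
  have hsum := HV.DDO.HasOrder.sum_mul_derivative (p := l + l' + (r + r')) hD
    (U := X * q * V) ?_ ?_
  · have hβ : ∀ k ∈ Finset.Icc (-(l' : ℤ)) (r' : ℤ),
        D.β k * (X * q * V).derivative.eval (k : ℝ) = c 0 * q.eval 0 * (D.β k * (-1) ^ k) := by
      intro k hk
      have h5 := shiftedChoose_mul_eval_derivative_nodal (hsub k hk)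
      have h6 : (X * q).eval (k : ℝ) = 0 := by
        by_cases hk0 : k = 0
        · subst hk0; simp
        · rw [eval_mul, puncturedNodal_eval_eq_zero (Finset.mem_erase.2 ⟨hk0, hsub k hk⟩), mul_zero]
      rw [derivative_mul, eval_add, eval_mul, eval_mul, h6, hVk k hk]
      have h7 : (-1 : ℝ) ^ k * (-1) ^ k = 1 := by
        rw [← mul_zpow]; norm_num
      rw [← hq, ← hc] at h5
      linear_combination (D.β k * (-1) ^ k) * h5 - D.β k * c k * (X * q).derivative.eval (k : ℝ) * h7
    simp only at hsum
    rw [Finset.sum_congr rfl hβ, ← Finset.mul_sum] at hsum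
    have h8 : (X * q * V).derivative.derivative.eval 0 =
        2 * q.derivative.eval 0 * c 0 + 2 * q.eval 0 * V.derivative.eval 0 := by
      simp [derivative_mul, hV0]; ring
    have h9 := shiftedChoose_zero_mul_derivative hlr (natDegree_puncturedNodal l r).le
    have h10 := shiftedChoose_zero_mul_derivative h' hVdeg
    rw [← hq, ← hc] at h9
    rw [← hb] at h10
    have h11 : ∀ k ∈ (Finset.Icc (-(l : ℤ)) (r : ℤ)).erase 0,
        (-1) ^ k * c k * ((q.eval (k : ℝ) - q.eval 0) / k) =
          -q.eval 0 * ((-1) ^ k * c k / k) := by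
      intro k hk
      rw [puncturedNodal_eval_eq_zero hk]; ring
    have h12 : ∀ k ∈ (Finset.Icc (-(l' : ℤ)) (r' : ℤ)).erase 0,
        (-1) ^ k * b k * ((V.eval (k : ℝ) - V.eval 0) / k) =
          (-1) ^ k * b k * ((c k - c 0) / k) := by
      intro k hk
      rw [hVk k (Finset.mem_of_mem_erase hk), hV0]
    rw [Finset.sum_congr rfl h11, ← Finset.mul_sum] at h9
    rw [Finset.sum_congr rfl h12] at h10
    rw [h8] at hsum
    refine mul_left_cancel₀ hq0 ?_
    linear_combination b 0 * hsum + 2 * b 0 * h9 + 2 * q.eval 0 * h10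
  · have := natDegree_mul_le (p := X * q) (q := V)
    have h3 := natDegree_mul_le (p := (X : ℝ[X])) (q := q)
    rw [natDegree_X, hq, natDegree_puncturedNodal] at h3
    rw [← hq] at h3
    omega
  · intro k hk
    rw [eval_mul, eval_mul]
    by_cases hk0 : k = 0
    · subst hk0; simp
    · rw [puncturedNodal_eval_eq_zero (Finset.mem_erase.2 ⟨hk0, hk⟩)]; simp

end

/-! ### Integral representation of the binomial sums -/

section

open MeasureTheory intervalIntegral Real Set

theorem one_add_exp_mul_I (a : ℝ) :
    1 + Complex.exp (a * Complex.I) =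
      ((2 * cos (a / 2) : ℝ) : ℂ) * Complex.exp ((a / 2 : ℝ) * Complex.I) := by
  push_cast
  rw [Complex.two_cos, add_mul, ← Complex.exp_add, ← Complex.exp_add, add_comm]
  congr 1
  · congr 1; ring
  · rw [← Complex.exp_zero]; congr 1; ring

/-- The trigonometric polynomial with binomial coefficients in closed form. -/
theorem sum_shiftedChoose_mul_exp (l r : ℕ) (a : ℝ) :
    ∑ k ∈ Finset.Icc (-(l : ℤ)) r,
        (shiftedChoose l r k : ℂ) * Complex.exp ((k * a : ℝ) * Complex.I) =
      (((2 * cos (a / 2)) ^ (l + r) : ℝ) : ℂ) *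
        Complex.exp (((r - l) * (a / 2) : ℝ) * Complex.I) := by
  rw [sum_Icc_neg_eq_sum_range]
  have h1 : ∀ i ∈ Finset.range (l + r + 1),
      (shiftedChoose l r (i - l) : ℂ) *
        Complex.exp (((((i : ℤ) - l : ℤ) : ℝ) * a : ℝ) * Complex.I) =
      Complex.exp ((-(l * a) : ℝ) * Complex.I) *
        (Complex.exp (a * Complex.I) ^ i * 1 ^ (l + r - i) * (l + r).choose i) := by
    intro i _
    rw [shiftedChoose_sub, ← Complex.exp_nat_mul, one_pow, mul_one, ← mul_assoc, ← Complex.exp_add,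
      mul_comm]
    congr 1
    · congr 1; push_cast; ring
  rw [Finset.sum_congr rfl h1, ← Finset.mul_sum, ← add_pow, add_comm, one_add_exp_mul_I, mul_pow,
    ← Complex.exp_nat_mul, mul_left_comm, ← Complex.exp_add]
  congr 1
  · push_cast; ring
  · congr 1; push_cast; ring

theorem sin_int_mul_sub_pi (k : ℤ) (x y : ℝ) :
    sin (k * (x - π) + y) = (-1) ^ k * sin (k * x + y) := by
  rw [show k * (x - π) + y = k * x + y - k * π by ring, sin_sub_int_mul_pi]

/-- The double trigonometric sum with binomial coefficients in closed form. -/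
theorem sum_sum_shiftedChoose_mul_sin (l r l' r' : ℕ) (φ ψ : ℝ) :
    ∑ k ∈ Finset.Icc (-(l' : ℤ)) r', ∑ j ∈ Finset.Icc (-(l : ℤ)) r,
        (-1) ^ k * shiftedChoose l' r' k * (shiftedChoose l r j * sin (k * ψ - j * φ)) =
      (2 * cos (φ / 2)) ^ (l + r) * (2 * sin (ψ / 2)) ^ (l' + r') *
        sin ((l - r) * (φ / 2) + (l' - r') * ((π - ψ) / 2)) := by
  -- The double sum is the imaginary part of a product of two one-variable sums; the shift of `ψ` by
  -- `π` supplies the sign `(-1) ^ k`.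
  have h1 := sum_shiftedChoose_mul_exp l r (-φ)
  have h2 := sum_shiftedChoose_mul_exp l' r' (ψ - π)
  have h3 := congrArg Complex.im (congrArg₂ (· * ·) h2 h1)
  simp only [Finset.sum_mul_sum, Complex.im_sum] at h3
  have h4 : ∀ a b x y : ℝ, ((a : ℂ) * Complex.exp ((x : ℝ) * Complex.I) *
      ((b : ℂ) * Complex.exp ((y : ℝ) * Complex.I))).im = a * (b * sin (x + y)) := by
    intro a b x y
    rw [mul_mul_mul_comm, ← Complex.exp_add, ← add_mul, ← Complex.ofReal_add, ← Complex.ofReal_mul,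
      Complex.im_ofReal_mul, Complex.exp_ofReal_mul_I_im, mul_assoc]
  simp only [h4] at h3
  have h5 : cos ((ψ - π) / 2) = sin (ψ / 2) := by
    rw [← cos_sub_pi_div_two]; congr 1; ring
  rw [h5, neg_div, cos_neg] at h3
  convert h3 using 1
  · refine Finset.sum_congr rfl fun k _ => Finset.sum_congr rfl fun j _ => ?_
    rw [show (j : ℝ) * -φ = -(j * φ) by ring, sin_int_mul_sub_pi,
      show (k : ℝ) * ψ + -(j * φ) = k * ψ - j * φ by ring]
    ring
  · rw [show ((r' : ℝ) - l') * ((ψ - π) / 2) + (r - l) * -(φ / 2) =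
      (l - r) * (φ / 2) + (l' - r') * ((π - ψ) / 2) by ring]
    ring

theorem integral_mul_sin_int {j : ℤ} (hj : j ≠ 0) :
    ∫ φ in (0 : ℝ)..π, φ * sin (j * φ) = -(π * (-1) ^ j / j) := by
  have hj' : (j : ℝ) ≠ 0 := by exact_mod_cast hj
  have hd : ∀ x ∈ uIcc 0 π, HasDerivAt
      (fun φ : ℝ => sin (j * φ) / (j : ℝ) ^ 2 - φ * cos (j * φ) / j) (x * sin (j * x)) x := by
    intro x _
    have h1 : HasDerivAt (fun φ : ℝ => (j : ℝ) * φ) j x := by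
      simpa using (hasDerivAt_id x).const_mul (j : ℝ)
    have := (h1.sin.div_const ((j : ℝ) ^ 2)).sub (((hasDerivAt_id x).mul h1.cos).div_const (j : ℝ))
    refine HasDerivAt.congr_deriv this ?_
    simp only [id]
    field_simp
    ring
  rw [integral_eq_sub_of_hasDerivAt hd (by apply Continuous.intervalIntegrable; fun_prop)]
  simp [sin_int_mul_pi, cos_int_mul_pi]

theorem integral_cos_int (j : ℤ) :
    ∫ φ in (0 : ℝ)..π, cos (j * φ) = if j = 0 then π else 0 := by
  split_ifs with hj
  · simp [hj]
  · have hj' : (j : ℝ) ≠ 0 := by exact_mod_cast hj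
    rw [integral_comp_mul_left (fun x => cos x) hj']
    simp [sin_int_mul_pi]

theorem integral_sin_mul_sub {k : ℝ} (hk : k ≠ 0) (j φ : ℝ) :
    ∫ ψ in (0 : ℝ)..φ, sin (k * ψ - j * φ) = (cos (j * φ) - cos ((k - j) * φ)) / k := by
  rw [integral_comp_mul_sub (fun x => sin x) hk]
  rw [integral_sin, mul_zero, zero_sub, cos_neg, smul_eq_mul, sub_mul]
  ring

/-- By orthogonality only `k = 0`, or `k ≠ 0` with `j = 0` or `j = k`, contributes. These are the
terms of the two sums in `alternating_sum`. -/
theorem integral_integral_sin_int (j k : ℤ) :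
    ∫ φ in (0 : ℝ)..π, ∫ ψ in (0 : ℝ)..φ, sin (k * ψ - j * φ) =
      if k = 0 then (if j = 0 then 0 else π * ((-1) ^ j / j))
      else ((if j = 0 then π else 0) - if j = k then π else 0) / k := by
  by_cases hk : k = 0
  · subst hk
    by_cases hj : j = 0
    · simp [hj]
    · simp [hj, integral_mul_sin_int hj]; ring
  · have hk' : (k : ℝ) ≠ 0 := by exact_mod_cast hk
    simp only [integral_sin_mul_sub hk', hk, if_false, intervalIntegral.integral_div]
    rw [intervalIntegral.integral_sub (by apply Continuous.intervalIntegrable; fun_prop)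
      (by apply Continuous.intervalIntegrable; fun_prop), integral_cos_int]
    have := integral_cos_int (k - j)
    push_cast at this
    rw [this]
    simp only [sub_eq_zero, eq_comm]

/-- The result is `π / 2` times the right side of `alternating_sum`, so the sign of the integral
decides the sign of `H(π)`. -/
theorem integral_integral_sum_shiftedChoose {l r l' r' : ℕ} (hl : l' ≤ l) (hr : r' ≤ r) :
    ∫ φ in (0 : ℝ)..π, ∫ ψ in (0 : ℝ)..φ,
      ∑ k ∈ Finset.Icc (-(l' : ℤ)) r', ∑ j ∈ Finset.Icc (-(l : ℤ)) r,
        (-1) ^ k * shiftedChoose l' r' k * (shiftedChoose l r j * sin (k * ψ - j * φ)) =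
    π * (shiftedChoose l' r' 0 *
        ∑ k ∈ (Finset.Icc (-(l : ℤ)) r).erase 0, (-1) ^ k * shiftedChoose l r k / k -
      ∑ k ∈ (Finset.Icc (-(l' : ℤ)) r').erase 0, (-1) ^ k * shiftedChoose l' r' k *
          ((shiftedChoose l r k - shiftedChoose l r 0) / k)) := by
  have hcont : ∀ j k : ℝ, Continuous fun φ : ℝ => ∫ ψ in (0 : ℝ)..φ, sin (k * ψ - j * φ) := by
    intro j k
    apply continuous_parametric_intervalIntegral_of_continuous
      (f := fun φ ψ : ℝ => sin (k * ψ - j * φ)) <;> fun_prop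
  have h1 : ∀ φ : ℝ, ∫ ψ in (0 : ℝ)..φ,
      ∑ k ∈ Finset.Icc (-(l' : ℤ)) r', ∑ j ∈ Finset.Icc (-(l : ℤ)) r,
        (-1) ^ k * shiftedChoose l' r' k * (shiftedChoose l r j * sin (k * ψ - j * φ)) =
      ∑ k ∈ Finset.Icc (-(l' : ℤ)) r', ∑ j ∈ Finset.Icc (-(l : ℤ)) r,
        (-1) ^ k * shiftedChoose l' r' k * (shiftedChoose l r j *
          ∫ ψ in (0 : ℝ)..φ, sin (k * ψ - j * φ)) := by
    intro φ
    rw [intervalIntegral.integral_finsetSum]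
    · refine Finset.sum_congr rfl fun k _ => ?_
      rw [intervalIntegral.integral_finsetSum]
      · simp only [intervalIntegral.integral_const_mul]
      · intro j _; apply Continuous.intervalIntegrable; fun_prop
    · intro k _; apply Continuous.intervalIntegrable; fun_prop
  simp only [h1]
  rw [intervalIntegral.integral_finsetSum]
  swap
  · intro k _
    exact (continuous_finsetSum _ fun (j : ℤ) _ =>
      ((hcont j k).const_mul _).const_mul _).intervalIntegrable _ _
  have h2 : ∀ k : ℤ, ∫ φ in (0 : ℝ)..π, ∑ j ∈ Finset.Icc (-(l : ℤ)) r,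
        (-1) ^ k * shiftedChoose l' r' k * (shiftedChoose l r j *
          ∫ ψ in (0 : ℝ)..φ, sin (k * ψ - j * φ)) =
      (-1) ^ k * shiftedChoose l' r' k * ∑ j ∈ Finset.Icc (-(l : ℤ)) r, shiftedChoose l r j *
        ∫ φ in (0 : ℝ)..π, ∫ ψ in (0 : ℝ)..φ, sin (k * ψ - j * φ) := by
    intro k
    rw [intervalIntegral.integral_finsetSum]
    · simp only [intervalIntegral.integral_const_mul, Finset.mul_sum]
    · intro j _
      exact (((hcont j k).const_mul _).const_mul _).intervalIntegrable _ _
  simp only [h2, integral_integral_sin_int]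
  rw [← Finset.add_sum_erase _ _ (zero_mem_Icc_neg l' r')]
  have h3 : ∀ k ∈ (Finset.Icc (-(l' : ℤ)) r').erase 0,
      ∑ j ∈ Finset.Icc (-(l : ℤ)) r, shiftedChoose l r j *
        (if k = 0 then (if j = 0 then 0 else π * ((-1) ^ j / j))
          else ((if j = 0 then π else 0) - if j = k then π else 0) / k) =
      -π * ((shiftedChoose l r k - shiftedChoose l r 0) / k) := by
    intro k hk
    obtain ⟨hk0, hk1⟩ := Finset.mem_erase.1 hk
    -- Every node of the stencil is a cell end point, so the resonant index `j = k` does occur in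
    -- the inner sum.
    have hk2 : k ∈ Finset.Icc (-(l : ℤ)) r := by
      simp only [Finset.mem_Icc] at *; omega
    simp only [hk0, if_false, mul_div_assoc', ← Finset.sum_div, mul_sub, Finset.sum_sub_distrib,
      mul_ite, mul_zero, Finset.sum_ite_eq', hk2, zero_mem_Icc_neg, if_true]
    ring
  have h4 : ∑ j ∈ Finset.Icc (-(l : ℤ)) r, shiftedChoose l r j *
        (if (0 : ℤ) = 0 then (if j = 0 then 0 else π * ((-1) ^ j / j))
          else ((if j = 0 then π else 0) - if j = 0 then π else 0) / (0 : ℤ)) =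
      π * ∑ k ∈ (Finset.Icc (-(l : ℤ)) r).erase 0, (-1) ^ k * shiftedChoose l r k / k := by
    rw [← Finset.add_sum_erase _ _ (zero_mem_Icc_neg l r), Finset.mul_sum]
    simp only [if_true, mul_zero, zero_add]
    refine Finset.sum_congr rfl fun j hj => ?_
    rw [if_neg (Finset.mem_erase.1 hj).1]
    ring
  have h5 : ∀ k ∈ (Finset.Icc (-(l' : ℤ)) r').erase 0,
      (-1) ^ k * shiftedChoose l' r' k * ∑ j ∈ Finset.Icc (-(l : ℤ)) r, shiftedChoose l r j *
        (if k = 0 then (if j = 0 then 0 else π * ((-1) ^ j / j))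
          else ((if j = 0 then π else 0) - if j = k then π else 0) / k) =
      -π * ((-1) ^ k * shiftedChoose l' r' k *
        ((shiftedChoose l r k - shiftedChoose l r 0) / k)) := by
    intro k hk
    rw [h3 k hk]; ring
  rw [h4, Finset.sum_congr rfl h5, ← Finset.mul_sum, zpow_zero]
  ring

end

/-! ### Folding the triangle and a criterion for negativity -/

section

open MeasureTheory intervalIntegral Real Set

/-- Exchanging the order of integration over a triangle. -/
theorem integral_integral_swap_triangle {f : ℝ → ℝ → ℝ} (hf : Continuous (Function.uncurry f))
    {h : ℝ} (hh : 0 ≤ h) :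
    ∫ x in (0 : ℝ)..h, ∫ y in x..h, f x y = ∫ y in (0 : ℝ)..h, ∫ x in (0 : ℝ)..y, f x y := by
  set T : Set (ℝ × ℝ) := {q | q.1 < q.2} with hT
  have hTm : MeasurableSet T := measurableSet_lt measurable_fst measurable_snd
  set g : ℝ → ℝ → ℝ := fun x y => T.indicator (Function.uncurry f) (x, y) with hg
  have hint : Integrable (Function.uncurry g)
      ((volume.restrict (Ioc 0 h)).prod (volume.restrict (Ioc 0 h))) := by
    rw [Measure.prod_restrict]
    have h1 : IntegrableOn (Function.uncurry f) (Ioc 0 h ×ˢ Ioc 0 h) (volume.prod volume) :=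
      (hf.continuousOn.integrableOn_compact (isCompact_Icc.prod isCompact_Icc)).mono_set
        (prod_mono Ioc_subset_Icc_self Ioc_subset_Icc_self)
    exact h1.indicator hTm
  have h2 := integral_integral_swap hint
  rw [intervalIntegral.integral_of_le hh, intervalIntegral.integral_of_le hh]
  refine Eq.trans ?_ (h2.trans ?_)
  · refine setIntegral_congr_fun measurableSet_Ioc fun x hx => ?_
    rw [intervalIntegral.integral_of_le hx.2]
    have : g x = (Ioi x).indicator (f x) := by
      funext y; simp [hg, hT, indicator]
    rw [this, setIntegral_indicator measurableSet_Ioi]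
    congr 2
    ext y
    simp only [mem_Ioc, mem_inter_iff, mem_Ioi]
    constructor
    · rintro ⟨h3, h4⟩; exact ⟨⟨hx.1.trans h3, h4⟩, h3⟩
    · rintro ⟨⟨-, h4⟩, h3⟩; exact ⟨h3, h4⟩
  · refine setIntegral_congr_fun measurableSet_Ioc fun y hy => ?_
    rw [intervalIntegral.integral_of_le hy.1.le]
    -- The indicator of the strict triangle excludes `x = y`, a null set.
    conv_rhs => rw [integral_Ioc_eq_integral_Ioo]
    have : (fun x => g x y) = (Iio y).indicator (fun x => f x y) := by
      funext x; simp [hg, hT, indicator]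
    rw [this, setIntegral_indicator measurableSet_Iio]
    congr 2
    ext x
    simp only [mem_Ioc, mem_inter_iff, mem_Iio, mem_Ioo]
    constructor
    · rintro ⟨⟨h3, -⟩, h4⟩; exact ⟨h3, h4⟩
    · rintro ⟨h3, h4⟩; exact ⟨⟨h3, h4.le.trans hy.2⟩, h4⟩

/-- Integration over the triangle `0 ≤ ψ ≤ φ ≤ π` in the coordinates `φ = π - u - v`,
`ψ = u - v`, folded by the symmetry `v ↦ -v`. -/
theorem integral_triangle_folded {f : ℝ → ℝ → ℝ} (hf : Continuous (Function.uncurry f)) :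
    ∫ φ in (0 : ℝ)..π, ∫ ψ in (0 : ℝ)..φ, f φ ψ =
      2 * ∫ v in (0 : ℝ)..(π / 2), ∫ u in v..(π / 2),
        (f (π - u - v) (u - v) + f (π - u + v) (u + v)) := by
  have hc : ∀ {a b : ℝ → ℝ}, Continuous a → Continuous b → Continuous fun x => f (a x) (b x) :=
    fun ha hb => hf.comp (ha.prodMk hb)
  -- The substitutions are `t = π - φ`, `θ = ψ + t`, then after a swap `θ = 2u` (hence the factor 2)
  -- and `t = u + v` with `-u ≤ v ≤ u`. The half `v < 0` is reflected, and a second swap puts `u`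
  -- inside.
  calc ∫ φ in (0 : ℝ)..π, ∫ ψ in (0 : ℝ)..φ, f φ ψ
      = ∫ t in (0 : ℝ)..π, ∫ ψ in (0 : ℝ)..(π - t), f (π - t) ψ := by
        rw [integral_comp_sub_left (fun φ => ∫ ψ in (0 : ℝ)..φ, f φ ψ)]; simp
    _ = ∫ t in (0 : ℝ)..π, ∫ θ in t..π, f (π - t) (θ - t) := by
        congr 1; funext t
        rw [integral_comp_sub_right (fun ψ => f (π - t) ψ)]; simp
    _ = ∫ θ in (0 : ℝ)..π, ∫ t in (0 : ℝ)..θ, f (π - t) (θ - t) := by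
        refine integral_integral_swap_triangle (f := fun t θ => f (π - t) (θ - t)) ?_ pi_pos.le
        exact hf.comp ((by fun_prop : Continuous fun q : ℝ × ℝ => (π - q.1, q.2 - q.1)))
    _ = 2 * ∫ u in (0 : ℝ)..(π / 2), ∫ t in (0 : ℝ)..(2 * u), f (π - t) (2 * u - t) := by
        rw [mul_integral_comp_mul_left (f := fun θ => ∫ t in (0 : ℝ)..θ, f (π - t) (θ - t))]
        congr 1 <;> ring
    _ = 2 * ∫ u in (0 : ℝ)..(π / 2), ∫ v in (0 : ℝ)..u,
          (f (π - u - v) (u - v) + f (π - u + v) (u + v)) := by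
        congr 2; funext u
        have h1 : ∫ t in (0 : ℝ)..(2 * u), f (π - t) (2 * u - t) =
            ∫ v in (-u)..u, f (π - u - v) (u - v) := by
          have h2 := integral_comp_sub_right (fun v => f (π - u - v) (u - v)) (a := 0) (b := 2 * u) u
          rw [zero_sub, show 2 * u - u = u by ring] at h2
          rw [← h2]
          congr 1; funext t; congr 1 <;> ring
        rw [h1, ← integral_add_adjacent_intervals (b := 0)
          ((hc (by fun_prop) (by fun_prop)).intervalIntegrable _ _)
          ((hc (by fun_prop) (by fun_prop)).intervalIntegrable _ _), integral_add
          ((hc (by fun_prop) (by fun_prop)).intervalIntegrable _ _)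
          ((hc (by fun_prop) (by fun_prop)).intervalIntegrable _ _), add_comm]
        congr 1
        have := integral_comp_neg (fun v => f (π - u + v) (u + v)) (a := -u) (b := 0)
        simp only [neg_neg, neg_zero, ← sub_eq_add_neg] at this
        exact this
    _ = _ := by
        congr 1
        refine (integral_integral_swap_triangle
          (f := fun v u => f (π - u - v) (u - v) + f (π - u + v) (u + v)) ?_ (by positivity)).symm
        exact (hf.comp ((by fun_prop : Continuous fun q : ℝ × ℝ => (π - q.2 - q.1, q.2 - q.1)))).add
          (hf.comp ((by fun_prop : Continuous fun q : ℝ × ℝ => (π - q.2 + q.1, q.2 + q.1))))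

/-- `sin u` is the `u`-derivative of `cos v - cos u`, which runs from `0` to `cos v`. -/
theorem integral_cos_sub_cos_pow_mul_sin (v : ℝ) (m : ℕ) :
    ∫ u in v..(π / 2), (cos v - cos u) ^ m * sin u = cos v ^ (m + 1) / (m + 1) := by
  have hd : ∀ u ∈ uIcc v (π / 2), HasDerivAt
      (fun u => (cos v - cos u) ^ (m + 1) / ((m : ℝ) + 1)) ((cos v - cos u) ^ m * sin u) u := by
    intro u _
    have := (((hasDerivAt_cos u).const_sub (cos v)).pow (m + 1)).div_const ((m : ℝ) + 1)
    refine HasDerivAt.congr_deriv this ?_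
    have h : (m : ℝ) + 1 ≠ 0 := by positivity
    push_cast
    field_simp
  rw [integral_eq_sub_of_hasDerivAt hd (by apply Continuous.intervalIntegrable; fun_prop)]
  simp

/-- Integrals of `(cos v - cos u) ^ n * sin u` times a cubic polynomial in `cos v - cos u`. -/
theorem integral_cos_sub_cos_pow_mul_cubic (v : ℝ) (n : ℕ) (a b c d : ℝ) :
    ∫ u in v..(π / 2), (cos v - cos u) ^ n * sin u * (a + b * (cos v - cos u) +
        c * (cos v - cos u) ^ 2 + d * (cos v - cos u) ^ 3) =
      cos v ^ (n + 1) * (a / (n + 1) + b * cos v / (n + 2) + c * cos v ^ 2 / (n + 3) +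
        d * cos v ^ 3 / (n + 4)) := by
  have h1 : ∀ u, (cos v - cos u) ^ n * sin u * (a + b * (cos v - cos u) +
        c * (cos v - cos u) ^ 2 + d * (cos v - cos u) ^ 3) =
      a * ((cos v - cos u) ^ n * sin u) + b * ((cos v - cos u) ^ (n + 1) * sin u) +
      c * ((cos v - cos u) ^ (n + 2) * sin u) + d * ((cos v - cos u) ^ (n + 3) * sin u) := by
    intro u; ring
  have hi : ∀ (e : ℝ) (m : ℕ), IntervalIntegrable
      (fun u => e * ((cos v - cos u) ^ m * sin u)) volume v (π / 2) := fun e m => by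
    apply Continuous.intervalIntegrable; fun_prop
  simp only [h1]
  rw [integral_add (((hi _ _).add (hi _ _)).add (hi _ _)) (hi _ _),
    integral_add ((hi _ _).add (hi _ _)) (hi _ _), integral_add (hi _ _) (hi _ _)]
  simp only [intervalIntegral.integral_const_mul, integral_cos_sub_cos_pow_mul_sin]
  push_cast
  rw [show (n : ℝ) + 1 + 1 = n + 2 by ring, show (n : ℝ) + 2 + 1 = n + 3 by ring,
    show (n : ℝ) + 3 + 1 = n + 4 by ring]
  ring

/-- A criterion for negativity of an integral over the triangle `0 ≤ ψ ≤ φ ≤ π`. -/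
theorem integral_triangle_neg {f : ℝ → ℝ → ℝ} (hf : Continuous (Function.uncurry f)) (n : ℕ)
    (a b c d : ℝ → ℝ) {K : ℝ} (hK : 0 < K)
    (ha : Continuous a) (hb : Continuous b) (hc : Continuous c) (hd : Continuous d)
    (hfold : ∀ u v, f (π - u - v) (u - v) + f (π - u + v) (u + v) =
      K * ((cos v - cos u) ^ n * sin u * (a (cos v) + b (cos v) * (cos v - cos u) +
        c (cos v) * (cos v - cos u) ^ 2 + d (cos v) * (cos v - cos u) ^ 3)))
    (hneg : ∀ s, 0 < s → s ≤ 1 → a s / (n + 1) + b s * s / (n + 2) + c s * s ^ 2 / (n + 3) +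
        d s * s ^ 3 / (n + 4) < 0) :
    ∫ φ in (0 : ℝ)..π, ∫ ψ in (0 : ℝ)..φ, f φ ψ < 0 := by
  rw [integral_triangle_folded hf]
  simp only [hfold, intervalIntegral.integral_const_mul, integral_cos_sub_cos_pow_mul_cubic]
  have hpos : 0 < ∫ v in (0 : ℝ)..(π / 2), -(cos v ^ (n + 1) * (a (cos v) / (n + 1) +
      b (cos v) * cos v / (n + 2) + c (cos v) * cos v ^ 2 / (n + 3) +
        d (cos v) * cos v ^ 3 / (n + 4))) := by
    refine intervalIntegral_pos_of_pos_on ?_ ?_ (by positivity)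
    · apply Continuous.intervalIntegrable
      have := continuous_cos
      fun_prop
    · intro v hv
      have hs : 0 < cos v := cos_pos_of_mem_Ioo ⟨by linarith [hv.1, pi_pos], hv.2⟩
      have := hneg _ hs (cos_le_one v)
      exact neg_pos.2 (mul_neg_of_pos_of_neg (by positivity) this)
  rw [intervalIntegral.integral_neg] at hpos
  nlinarith [mul_pos hK (neg_pos.1 (by simpa using hpos) |> neg_pos.2)]

end

/-! ### Negativity of the eight kernels -/

section

open MeasureTheory intervalIntegral Real Set

/-- The closed form of the double trigonometric sum, for `n = l' + r'`, `l + r = n + e`,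
`m = l - r` and `m' = l' - r'`. -/
noncomputable def triangleKernel (n e : ℕ) (m m' φ ψ : ℝ) : ℝ :=
  (2 * cos (φ / 2)) ^ (n + e) * (2 * sin (ψ / 2)) ^ n * sin (m * (φ / 2) + m' * ((π - ψ) / 2))

theorem continuous_triangleKernel (n e : ℕ) (m m' : ℝ) :
    Continuous (Function.uncurry (triangleKernel n e m m')) := by
  unfold triangleKernel Function.uncurry
  fun_prop

/-- In the new coordinates `cos (φ / 2)` and `sin (ψ / 2)` become `sin ((u + v) / 2)` and `sin ((u -
v) / 2)`, and folding swaps them. Their product is symmetric, so its `n`-th power factors out; only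
the `e` surplus cosines and the phase differ. -/
theorem triangleKernel_fold (n e : ℕ) (m m' u v : ℝ) :
    triangleKernel n e m m' (π - u - v) (u - v) + triangleKernel n e m m' (π - u + v) (u + v) =
      2 ^ n * (cos v - cos u) ^ n *
        ((2 * sin ((u + v) / 2)) ^ e *
            sin ((m + m') * (π / 2) - (m * ((u + v) / 2) + m' * ((u - v) / 2))) +
          (2 * sin ((u - v) / 2)) ^ e *
            sin ((m + m') * (π / 2) - (m * ((u - v) / 2) + m' * ((u + v) / 2)))) := by
  have h1 : 2 ^ n * (cos v - cos u) ^ n =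
      (2 * sin ((u + v) / 2)) ^ n * (2 * sin ((u - v) / 2)) ^ n := by
    rw [← mul_pow, ← mul_pow, cos_sub_cos, show (v - u) / 2 = -((u - v) / 2) by ring, sin_neg,
      add_comm v u]
    ring
  have h2 : cos ((π - u - v) / 2) = sin ((u + v) / 2) := by
    rw [← cos_pi_div_two_sub]; congr 1; ring
  have h3 : cos ((π - u + v) / 2) = sin ((u - v) / 2) := by
    rw [← cos_pi_div_two_sub]; congr 1; ring
  rw [h1, triangleKernel, triangleKernel, h2, h3,
    show m * ((π - u - v) / 2) + m' * ((π - (u - v)) / 2) =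
      (m + m') * (π / 2) - (m * ((u + v) / 2) + m' * ((u - v) / 2)) by ring,
    show m * ((π - u + v) / 2) + m' * ((π - (u + v)) / 2) =
      (m + m') * (π / 2) - (m * ((u - v) / 2) + m' * ((u + v) / 2)) by ring]
  ring

theorem sin_three_mul_eq (u : ℝ) : sin (3 * u) = sin u * (4 * cos u ^ 2 - 1) := by
  rw [sin_three_mul]; linear_combination -4 * sin u * sin_sq_add_cos_sq u

theorem sin_four_mul_eq (u : ℝ) : sin (4 * u) = sin u * (8 * cos u ^ 3 - 4 * cos u) := by
  rw [show 4 * u = 2 * (2 * u) by ring, sin_two_mul, sin_two_mul, cos_two_mul]; ring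

theorem sq_two_mul_sin_add (u v : ℝ) :
    (2 * sin ((u + v) / 2)) ^ 2 + (2 * sin ((u - v) / 2)) ^ 2 = 4 * (1 - cos u * cos v) := by
  have h : ∀ x : ℝ, (2 * sin (x / 2)) ^ 2 = 2 - 2 * cos x := by
    intro x
    have h1 := cos_two_mul (x / 2)
    rw [mul_div_cancel₀ x two_ne_zero] at h1
    linear_combination 4 * sin_sq_add_cos_sq (x / 2) + 2 * h1
  rw [h, h, cos_add, cos_sub]; ring

/-- The multiple of `π / 2` is `m + m' = L - R`; its residue mod 4 decides which of `±sin`, `±cos`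
the phase becomes. -/
theorem sin_four_mul_pi_div_two_sub (x : ℝ) : sin (4 * (π / 2) - x) = -sin x := by
  rw [show 4 * (π / 2) - x = 2 * π - x by ring, sin_two_pi_sub]

theorem sin_five_mul_pi_div_two_sub (x : ℝ) : sin (5 * (π / 2) - x) = cos x := by
  rw [show 5 * (π / 2) - x = π / 2 - x + 2 * π by ring, sin_add_two_pi, sin_pi_div_two_sub]

theorem sin_six_mul_pi_div_two_sub (x : ℝ) : sin (6 * (π / 2) - x) = sin x := by
  rw [show 6 * (π / 2) - x = π - x + 2 * π by ring, sin_add_two_pi, sin_pi_sub]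

theorem sin_seven_mul_pi_div_two_sub (x : ℝ) : sin (7 * (π / 2) - x) = -cos x := by
  rw [show 7 * (π / 2) - x = π / 2 - x + π + 2 * π by ring, sin_add_two_pi, sin_add_pi,
    sin_pi_div_two_sub]

/-- Here and in the next seven lemmas the words in the name are `m` and `m'`. The coefficients `a,
b, c, d` arise from the folded bracket divided by `sin u`, on putting `cos v = s` and `cos u = s -
t` and expanding in `t`. -/
theorem integral_triangleKernel_two_two (n : ℕ) :
    ∫ φ in (0 : ℝ)..π, ∫ ψ in (0 : ℝ)..φ, triangleKernel n 0 2 2 φ ψ < 0 := by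
  refine integral_triangle_neg (continuous_triangleKernel _ _ _ _) n (fun s => -2 * s)
    (fun _ => 2) (fun _ => 0) (fun _ => 0) (K := 2 ^ n * 2) (by positivity) (by fun_prop)
    (by fun_prop) (by fun_prop) (by fun_prop) (fun u v => ?_) (fun s hs hs1 => ?_)
  · rw [triangleKernel_fold, show (2 : ℝ) + 2 = 4 by norm_num, sin_four_mul_pi_div_two_sub,
      sin_four_mul_pi_div_two_sub, show 2 * ((u + v) / 2) + 2 * ((u - v) / 2) = 2 * u by ring,
      show 2 * ((u - v) / 2) + 2 * ((u + v) / 2) = 2 * u by ring, sin_two_mul]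
    ring
  · have e : -2 * s / ((n : ℝ) + 1) + 2 * s / (n + 2) + 0 * s ^ 2 / (n + 3) +
        0 * s ^ 3 / (n + 4) = -(2 * s / ((n + 1) * (n + 2))) := by
      field_simp; ring
    rw [e, neg_lt_zero]
    positivity

theorem integral_triangleKernel_two_two' (n : ℕ) :
    ∫ φ in (0 : ℝ)..π, ∫ ψ in (0 : ℝ)..φ, triangleKernel n 2 2 2 φ ψ < 0 := by
  refine integral_triangle_neg (continuous_triangleKernel _ _ _ _) n (fun s => -2 * (s - s ^ 3))
    (fun s => -2 * (2 * s ^ 2 - 1)) (fun s => 2 * s) (fun _ => 0) (K := 2 ^ n * 4) (by positivity)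
    (by fun_prop) (by fun_prop) (by fun_prop) (by fun_prop) (fun u v => ?_) (fun s hs hs1 => ?_)
  · rw [triangleKernel_fold, show (2 : ℝ) + 2 = 4 by norm_num, sin_four_mul_pi_div_two_sub,
      sin_four_mul_pi_div_two_sub, show 2 * ((u + v) / 2) + 2 * ((u - v) / 2) = 2 * u by ring,
      show 2 * ((u - v) / 2) + 2 * ((u + v) / 2) = 2 * u by ring, ← add_mul, sq_two_mul_sin_add,
      sin_two_mul]
    ring
  · have e : -2 * (s - s ^ 3) / ((n : ℝ) + 1) + -2 * (2 * s ^ 2 - 1) * s / (n + 2) +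
        2 * s * s ^ 2 / (n + 3) + 0 * s ^ 3 / (n + 4) =
        s * (4 * s ^ 2 - 2 * (n + 3)) / ((n + 1) * (n + 2) * (n + 3)) := by
      field_simp; ring
    rw [e]
    refine div_neg_of_neg_of_pos (mul_neg_of_pos_of_neg hs ?_) (by positivity)
    have hn : (0 : ℝ) ≤ n := n.cast_nonneg
    nlinarith

/-- For `e = 1` the surplus sine and the cosine phase combine by product-to-sum. The terms odd in
`v` cancel in the fold, and what is left is divisible by `sin u`. -/
theorem integral_triangleKernel_three_two (n : ℕ) (hn : 1 ≤ n) :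
    ∫ φ in (0 : ℝ)..π, ∫ ψ in (0 : ℝ)..φ, triangleKernel n 1 3 2 φ ψ < 0 := by
  refine integral_triangle_neg (continuous_triangleKernel _ _ _ _) n (fun s => 4 * s ^ 3 - 3 * s)
    (fun s => 2 - 8 * s ^ 2) (fun s => 4 * s) (fun _ => 0) (K := 2 ^ n * 2) (by positivity)
    (by fun_prop) (by fun_prop) (by fun_prop) (by fun_prop) (fun u v => ?_) (fun s hs hs1 => ?_)
  · rw [triangleKernel_fold, show (3 : ℝ) + 2 = 5 by norm_num, sin_five_mul_pi_div_two_sub,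
      sin_five_mul_pi_div_two_sub, pow_one, pow_one, two_mul_sin_mul_cos, two_mul_sin_mul_cos,
      show (u + v) / 2 + (3 * ((u + v) / 2) + 2 * ((u - v) / 2)) = 3 * u + v by ring,
      show (u + v) / 2 - (3 * ((u + v) / 2) + 2 * ((u - v) / 2)) = -(2 * u) by ring,
      show (u - v) / 2 + (3 * ((u - v) / 2) + 2 * ((u + v) / 2)) = 3 * u - v by ring,
      show (u - v) / 2 - (3 * ((u - v) / 2) + 2 * ((u + v) / 2)) = -(2 * u) by ring,
      sin_neg, sin_add (3 * u), sin_sub (3 * u), sin_three_mul_eq, sin_two_mul]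
    ring
  · have e : (4 * s ^ 3 - 3 * s) / ((n : ℝ) + 1) + (2 - 8 * s ^ 2) * s / (n + 2) +
        4 * s * s ^ 2 / (n + 3) + 0 * s ^ 3 / (n + 4) =
        s * (8 * s ^ 2 - (n + 2) * (n + 3) - 2 * (n + 3)) / ((n + 1) * (n + 2) * (n + 3)) := by
      field_simp; ring
    rw [e]
    refine div_neg_of_neg_of_pos (mul_neg_of_pos_of_neg hs ?_) (by positivity)
    have hn : (1 : ℝ) ≤ n := by exact_mod_cast hn
    nlinarith

theorem integral_triangleKernel_two_three (n : ℕ) (hn : 1 ≤ n) :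
    ∫ φ in (0 : ℝ)..π, ∫ ψ in (0 : ℝ)..φ, triangleKernel n 1 2 3 φ ψ < 0 := by
  refine integral_triangle_neg (continuous_triangleKernel _ _ _ _) n (fun s => 2 * s ^ 2 - 1)
    (fun s => -6 * s) (fun _ => 4) (fun _ => 0) (K := 2 ^ n * 2) (by positivity)
    (by fun_prop) (by fun_prop) (by fun_prop) (by fun_prop) (fun u v => ?_) (fun s hs hs1 => ?_)
  · rw [triangleKernel_fold, show (2 : ℝ) + 3 = 5 by norm_num, sin_five_mul_pi_div_two_sub,
      sin_five_mul_pi_div_two_sub, pow_one, pow_one, two_mul_sin_mul_cos, two_mul_sin_mul_cos,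
      show (u + v) / 2 + (2 * ((u + v) / 2) + 3 * ((u - v) / 2)) = 3 * u by ring,
      show (u + v) / 2 - (2 * ((u + v) / 2) + 3 * ((u - v) / 2)) = -(2 * u - v) by ring,
      show (u - v) / 2 + (2 * ((u - v) / 2) + 3 * ((u + v) / 2)) = 3 * u by ring,
      show (u - v) / 2 - (2 * ((u - v) / 2) + 3 * ((u + v) / 2)) = -(2 * u + v) by ring,
      sin_neg, sin_neg, sin_add (2 * u), sin_sub (2 * u), sin_three_mul_eq, sin_two_mul]
    ring
  · have e : (2 * s ^ 2 - 1) / ((n : ℝ) + 1) + -6 * s * s / (n + 2) +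
        4 * s ^ 2 / (n + 3) + 0 * s ^ 3 / (n + 4) =
        (8 * s ^ 2 - (n + 2) * (n + 3) - 2 * s ^ 2 * (n + 3)) /
          ((n + 1) * (n + 2) * (n + 3)) := by
      field_simp; ring
    rw [e]
    refine div_neg_of_neg_of_pos ?_ (by positivity)
    have hn : (1 : ℝ) ≤ n := by exact_mod_cast hn
    nlinarith [mul_nonneg (sq_nonneg s) (by linarith : (0 : ℝ) ≤ n)]

/-- For `n = 2` the final numerator would vanish at `s = 1`. In the application `l' = r' + 3` forces
`n ≥ 3`. -/
theorem integral_triangleKernel_four_three (n : ℕ) (hn : 3 ≤ n) :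
    ∫ φ in (0 : ℝ)..π, ∫ ψ in (0 : ℝ)..φ, triangleKernel n 1 4 3 φ ψ < 0 := by
  refine integral_triangle_neg (continuous_triangleKernel _ _ _ _) n
    (fun s => 8 * s ^ 2 - 1 - 8 * s ^ 4) (fun s => 24 * s ^ 3 - 12 * s) (fun s => 4 - 24 * s ^ 2)
    (fun s => 8 * s) (K := 2 ^ n * 2) (by positivity)
    (by fun_prop) (by fun_prop) (by fun_prop) (by fun_prop) (fun u v => ?_) (fun s hs hs1 => ?_)
  · rw [triangleKernel_fold, show (4 : ℝ) + 3 = 7 by norm_num, sin_seven_mul_pi_div_two_sub,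
      sin_seven_mul_pi_div_two_sub, pow_one, pow_one, mul_neg, mul_neg, two_mul_sin_mul_cos,
      two_mul_sin_mul_cos,
      show (u + v) / 2 + (4 * ((u + v) / 2) + 3 * ((u - v) / 2)) = 4 * u + v by ring,
      show (u + v) / 2 - (4 * ((u + v) / 2) + 3 * ((u - v) / 2)) = -(3 * u) by ring,
      show (u - v) / 2 + (4 * ((u - v) / 2) + 3 * ((u + v) / 2)) = 4 * u - v by ring,
      show (u - v) / 2 - (4 * ((u - v) / 2) + 3 * ((u + v) / 2)) = -(3 * u) by ring,
      sin_neg, sin_add (4 * u), sin_sub (4 * u), sin_three_mul_eq, sin_four_mul_eq]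
    ring
  · have e : (8 * s ^ 2 - 1 - 8 * s ^ 4) / ((n : ℝ) + 1) + (24 * s ^ 3 - 12 * s) * s / (n + 2) +
        (4 - 24 * s ^ 2) * s ^ 2 / (n + 3) + 8 * s * s ^ 3 / (n + 4) =
        (8 * s ^ 2 * (n + 4) - (n + 2) * (n + 3) * (n + 4) - 48 * (s ^ 2) ^ 2 +
          4 * s ^ 2 * (n + 3) * (n + 4)) / ((n + 1) * (n + 2) * (n + 3) * (n + 4)) := by
      field_simp; ring
    rw [e]
    refine div_neg_of_neg_of_pos ?_ (by positivity)
    have ht0 : 0 < s ^ 2 := by positivity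
    have ht1 : s ^ 2 ≤ 1 := pow_le_one₀ hs.le hs1
    -- In powers of `k = n - 3` the numerator has coefficients `224t - 210 - 48t²`, `60t - 107`, `4t
    -- - 18` and `-1`, all negative for `0 < t ≤ 1`.
    obtain ⟨k, rfl⟩ := Nat.exists_eq_add_of_le hn
    have hk : (0 : ℝ) ≤ k := k.cast_nonneg
    generalize s ^ 2 = t at *
    push_cast
    have h1 : 224 * t - 210 - 48 * t ^ 2 < 0 := by nlinarith
    have h2 : (k : ℝ) * (32 * t - 30 - 7 * (11 - 4 * t)) ≤ 0 :=
      mul_nonpos_of_nonneg_of_nonpos hk (by linarith)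
    have h3 : (k : ℝ) ^ 2 * (4 * t - 18) ≤ 0 :=
      mul_nonpos_of_nonneg_of_nonpos (by positivity) (by linarith)
    have h4 : 0 ≤ (k : ℝ) ^ 3 := by positivity
    nlinarith

/-- The bound on `n` is what gives strictness: for `n = 2` the numerator below is identically zero.
-/
theorem integral_triangleKernel_three_four (n : ℕ) (hn : 3 ≤ n) :
    ∫ φ in (0 : ℝ)..π, ∫ ψ in (0 : ℝ)..φ, triangleKernel n 1 3 4 φ ψ < 0 := by
  refine integral_triangle_neg (continuous_triangleKernel _ _ _ _) n
    (fun s => 3 * s - 4 * s ^ 3) (fun s => 16 * s ^ 2 - 4) (fun s => -20 * s)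
    (fun _ => 8) (K := 2 ^ n * 2) (by positivity)
    (by fun_prop) (by fun_prop) (by fun_prop) (by fun_prop) (fun u v => ?_) (fun s hs hs1 => ?_)
  · rw [triangleKernel_fold, show (3 : ℝ) + 4 = 7 by norm_num, sin_seven_mul_pi_div_two_sub,
      sin_seven_mul_pi_div_two_sub, pow_one, pow_one, mul_neg, mul_neg, two_mul_sin_mul_cos,
      two_mul_sin_mul_cos,
      show (u + v) / 2 + (3 * ((u + v) / 2) + 4 * ((u - v) / 2)) = 4 * u by ring,
      show (u + v) / 2 - (3 * ((u + v) / 2) + 4 * ((u - v) / 2)) = -(3 * u - v) by ring,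
      show (u - v) / 2 + (3 * ((u - v) / 2) + 4 * ((u + v) / 2)) = 4 * u by ring,
      show (u - v) / 2 - (3 * ((u - v) / 2) + 4 * ((u + v) / 2)) = -(3 * u + v) by ring,
      sin_neg, sin_neg, sin_add (3 * u), sin_sub (3 * u), sin_three_mul_eq, sin_four_mul_eq]
    ring
  · have e : (3 * s - 4 * s ^ 3) / ((n : ℝ) + 1) + (16 * s ^ 2 - 4) * s / (n + 2) +
        -20 * s * s ^ 2 / (n + 3) + 8 * s ^ 3 / (n + 4) =
        s * (8 * s ^ 2 * (n + 4) - (n + 2) * (n + 3) * (n + 4) - 48 * s ^ 2 +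
          4 * (n + 3) * (n + 4)) / ((n + 1) * (n + 2) * (n + 3) * (n + 4)) := by
      field_simp; ring
    rw [e]
    refine div_neg_of_neg_of_pos (mul_neg_of_pos_of_neg hs ?_) (by positivity)
    have ht0 : 0 < s ^ 2 := by positivity
    have ht1 : s ^ 2 ≤ 1 := pow_le_one₀ hs.le hs1
    obtain ⟨k, rfl⟩ := Nat.exists_eq_add_of_le hn
    have hk : (0 : ℝ) ≤ k := k.cast_nonneg
    generalize s ^ 2 = t at *
    push_cast
    have h1 : (k : ℝ) * (8 * t - 8) ≤ 0 := mul_nonpos_of_nonneg_of_nonpos hk (by linarith)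
    have h2 : 0 ≤ (k : ℝ) ^ 2 := by positivity
    have h3 : 0 ≤ (k : ℝ) ^ 3 := by positivity
    nlinarith

theorem integral_triangleKernel_three_three (n : ℕ) (hn : 1 ≤ n) :
    ∫ φ in (0 : ℝ)..π, ∫ ψ in (0 : ℝ)..φ, triangleKernel n 0 3 3 φ ψ < 0 := by
  refine integral_triangle_neg (continuous_triangleKernel _ _ _ _) n (fun s => 4 * s ^ 2 - 1)
    (fun s => -8 * s) (fun _ => 4) (fun _ => 0) (K := 2 ^ n * 2) (by positivity) (by fun_prop)
    (by fun_prop) (by fun_prop) (by fun_prop) (fun u v => ?_) (fun s hs hs1 => ?_)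
  · rw [triangleKernel_fold, show (3 : ℝ) + 3 = 6 by norm_num, sin_six_mul_pi_div_two_sub,
      sin_six_mul_pi_div_two_sub, show 3 * ((u + v) / 2) + 3 * ((u - v) / 2) = 3 * u by ring,
      show 3 * ((u - v) / 2) + 3 * ((u + v) / 2) = 3 * u by ring, sin_three_mul_eq]
    ring
  · have e : (4 * s ^ 2 - 1) / ((n : ℝ) + 1) + -8 * s * s / (n + 2) + 4 * s ^ 2 / (n + 3) +
        0 * s ^ 3 / (n + 4) =
        (8 * s ^ 2 - (n + 2) * (n + 3)) / ((n + 1) * (n + 2) * (n + 3)) := by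
      field_simp; ring
    rw [e]
    refine div_neg_of_neg_of_pos ?_ (by positivity)
    have hn : (1 : ℝ) ≤ n := by exact_mod_cast hn
    nlinarith

theorem integral_triangleKernel_three_three' (n : ℕ) (hn : 1 ≤ n) :
    ∫ φ in (0 : ℝ)..π, ∫ ψ in (0 : ℝ)..φ, triangleKernel n 2 3 3 φ ψ < 0 := by
  refine integral_triangle_neg (continuous_triangleKernel _ _ _ _) n
    (fun s => 5 * s ^ 2 - 1 - 4 * s ^ 4) (fun s => 12 * s ^ 3 - 9 * s) (fun s => 4 - 12 * s ^ 2)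
    (fun s => 4 * s) (K := 2 ^ n * 4) (by positivity) (by fun_prop)
    (by fun_prop) (by fun_prop) (by fun_prop) (fun u v => ?_) (fun s hs hs1 => ?_)
  · rw [triangleKernel_fold, show (3 : ℝ) + 3 = 6 by norm_num, sin_six_mul_pi_div_two_sub,
      sin_six_mul_pi_div_two_sub, show 3 * ((u + v) / 2) + 3 * ((u - v) / 2) = 3 * u by ring,
      show 3 * ((u - v) / 2) + 3 * ((u + v) / 2) = 3 * u by ring, ← add_mul, sq_two_mul_sin_add,
      sin_three_mul_eq]
    ring
  · have e : (5 * s ^ 2 - 1 - 4 * s ^ 4) / ((n : ℝ) + 1) + (12 * s ^ 3 - 9 * s) * s / (n + 2) +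
        (4 - 12 * s ^ 2) * s ^ 2 / (n + 3) + 4 * s * s ^ 3 / (n + 4) =
        (8 * s ^ 2 * (n + 4) - (n + 2) * (n + 3) * (n + 4) - 24 * (s ^ 2) ^ 2 +
          s ^ 2 * (n + 3) * (n + 4)) / ((n + 1) * (n + 2) * (n + 3) * (n + 4)) := by
      field_simp; ring
    rw [e]
    refine div_neg_of_neg_of_pos ?_ (by positivity)
    have ht0 : 0 < s ^ 2 := by positivity
    have ht1 : s ^ 2 ≤ 1 := pow_le_one₀ hs.le hs1
    obtain ⟨k, rfl⟩ := Nat.exists_eq_add_of_le hn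
    have hk : (0 : ℝ) ≤ k := k.cast_nonneg
    generalize s ^ 2 = t at *
    push_cast
    have h1 : 60 * t - 60 - 24 * t ^ 2 < 0 := by nlinarith
    have h2 : (k : ℝ) * (17 * t - 47) ≤ 0 := mul_nonpos_of_nonneg_of_nonpos hk (by linarith)
    have h3 : (k : ℝ) ^ 2 * (t - 12) ≤ 0 :=
      mul_nonpos_of_nonneg_of_nonpos (by positivity) (by linarith)
    have h4 : 0 ≤ (k : ℝ) ^ 3 := by positivity
    nlinarith

/-- The alternating sum of the nodal coefficients is negative. -/
theorem HV.DDO.IsOptimal.alternating_sum_neg {s : HV.Stencil} {D : HV.DDO s} (hD : D.IsOptimal)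
    (hs : s.IsContiguous) (h4 : s.R + 4 ≤ s.L) (h7 : s.L ≤ s.R + 7) :
    ∑ k ∈ Finset.Icc (-(s.l' : ℤ)) s.r', D.β k * (-1) ^ k < 0 := by
  have hsum := hD.alternating_sum hs
  obtain ⟨l, r, l', r'⟩ := s
  simp only [HV.Stencil.IsContiguous, HV.Stencil.L, HV.Stencil.R] at *
  have hint := integral_integral_sum_shiftedChoose hs.1.1 hs.2.1
  have hneg : ∫ φ in (0 : ℝ)..π, ∫ ψ in (0 : ℝ)..φ,
      (2 * cos (φ / 2)) ^ (l + r) * (2 * sin (ψ / 2)) ^ (l' + r') *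
        sin ((l - r) * (φ / 2) + (l' - r') * ((π - ψ) / 2)) < 0 := by
    have key : ∀ e m m' : ℕ, l + r = l' + r' + e → l = r + m → l' = r' + m' →
        ∫ φ in (0 : ℝ)..π, ∫ ψ in (0 : ℝ)..φ, triangleKernel (l' + r') e m m' φ ψ < 0 →
        ∫ φ in (0 : ℝ)..π, ∫ ψ in (0 : ℝ)..φ,
          (2 * cos (φ / 2)) ^ (l + r) * (2 * sin (ψ / 2)) ^ (l' + r') *
            sin ((l - r) * (φ / 2) + (l' - r') * ((π - ψ) / 2)) < 0 := by
      intro e m m' h1 h2 h3 h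
      have e2 : (l : ℝ) - r = m := by rw [h2]; push_cast; ring
      have e3 : (l' : ℝ) - r' = m' := by rw [h3]; push_cast; ring
      simpa only [triangleKernel, h1, e2, e3] using h
    obtain ⟨⟨a1, a2⟩, b1, b2⟩ := hs
    -- The excess `e` counts the sides on which the outermost entity is a cell. It fixes the parity
    -- relation between `m` and `m'`, and `m + m' = L - R` then leaves exactly eight triples `(e, m,
    -- m')`.
    rcases (by omega : l = l' ∨ l = l' + 1) with ha | ha <;>
    rcases (by omega : r = r' ∨ r = r' + 1) with hb | hb
    · rcases (by omega : l' = r' + 2 ∨ l' = r' + 3) with hd | hd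
      · exact key 0 2 2 (by omega) (by omega) hd
          (by exact_mod_cast integral_triangleKernel_two_two (l' + r'))
      · exact key 0 3 3 (by omega) (by omega) hd
          (by exact_mod_cast integral_triangleKernel_three_three (l' + r') (by omega))
    · rcases (by omega : l' = r' + 3 ∨ l' = r' + 4) with hd | hd
      · exact key 1 2 3 (by omega) (by omega) hd
          (by exact_mod_cast integral_triangleKernel_two_three (l' + r') (by omega))
      · exact key 1 3 4 (by omega) (by omega) hd
          (by exact_mod_cast integral_triangleKernel_three_four (l' + r') (by omega))
    · rcases (by omega : l' = r' + 2 ∨ l' = r' + 3) with hd | hd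
      · exact key 1 3 2 (by omega) (by omega) hd
          (by exact_mod_cast integral_triangleKernel_three_two (l' + r') (by omega))
      · exact key 1 4 3 (by omega) (by omega) hd
          (by exact_mod_cast integral_triangleKernel_four_three (l' + r') (by omega))
    · rcases (by omega : l' = r' + 2 ∨ l' = r' + 3) with hd | hd
      · exact key 2 2 2 (by omega) (by omega) hd
          (by exact_mod_cast integral_triangleKernel_two_two' (l' + r'))
      · exact key 2 3 3 (by omega) (by omega) hd
          (by exact_mod_cast integral_triangleKernel_three_three' (l' + r') (by omega))
  simp only [← sum_sum_shiftedChoose_mul_sin] at hneg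
  rw [hint] at hneg
  have hsum' := hsum (by omega)
  have h1 := neg_of_mul_neg_right hneg pi_pos.le
  have h2 : 0 < shiftedChoose l r 0 * shiftedChoose l' r' 0 :=
    mul_pos (shiftedChoose_pos (zero_mem_Icc_neg l r)) (shiftedChoose_pos (zero_mem_Icc_neg l' r'))
  refine neg_of_mul_neg_right (a := shiftedChoose l r 0 * shiftedChoose l' r' 0) ?_ h2.le
  rw [hsum']
  linarith

end

/-! ### From the root at `θ = π` to an unstable eigenvalue -/

section

open Real

namespace HV.DDO

variable {s : Stencil}

theorem exp_I_mul_int_mul_pi (k : ℤ) :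
    Complex.exp (Complex.I * k * (π : ℝ)) = (-1) ^ k := by
  rw [show Complex.I * k * (π : ℝ) = k * (π * Complex.I) by ring, Complex.exp_int_mul,
    Complex.exp_pi_mul_I]

theorem H_pi (D : DDO s) :
    D.H π = ∑ k ∈ Finset.Icc (-(s.l' : ℤ)) s.r', (D.β k : ℂ) * (-1) ^ k := by
  simp only [H, exp_I_mul_int_mul_pi]

theorem F_pi (D : DDO s) : D.F π = -2 * D.G π := by
  have := exp_I_mul_int_mul_pi 1
  simp only [Int.cast_one, mul_one, zpow_one] at this
  rw [F, this]; ring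

/-- A monic quadratic polynomial whose roots have a sum with negative real part has a root with
negative real part. -/
theorem exists_root_re_neg {b c : ℂ} (hb : b.re < 0) :
    ∃ z : ℂ, z.re < 0 ∧ z ^ 2 - b * z - c = 0 := by
  obtain ⟨w, hw⟩ := IsAlgClosed.exists_pow_nat_eq (b ^ 2 + 4 * c) two_pos
  by_cases h : w.re ≤ 0
  · refine ⟨(b + w) / 2, ?_, by linear_combination hw / 4⟩
    simp; linarith
  · refine ⟨(b - w) / 2, ?_, by linear_combination hw / 4⟩
    simp; linarith

/-- The alternating grid function on `ZMod N`, for even `N`. -/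
noncomputable def alternating (N : ℕ) (j : ZMod N) : ℂ := (-1) ^ j.val

/-- The parity of the representative survives the wrap-around because `N` is even. -/
theorem alternating_add_one {N : ℕ} [NeZero N] (hN : Even N) (j : ZMod N) :
    alternating N (j + 1) = -alternating N j := by
  have h1 : (j + 1).val = (j.val + 1) % N := by
    have h2 : 1 < N := by
      obtain ⟨m, hm⟩ := hN
      have := NeZero.ne N
      omega
    rw [ZMod.val_add, ZMod.val_one'' (by omega)]
  rw [alternating, alternating, h1, ← pow_eq_pow_mod _ hN.neg_one_pow, pow_succ]
  ring

theorem alternating_add_intCast {N : ℕ} [NeZero N] (hN : Even N) (j : ZMod N) (k : ℤ) :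
    alternating N (j + k) = (-1) ^ k * alternating N j := by
  induction k using Int.induction_on with
  | zero => simp
  | succ n ih =>
    push_cast at ih ⊢
    rw [← add_assoc, alternating_add_one hN, ih, zpow_add₀ (by norm_num)]
    simp
  | pred n ih =>
    have h := alternating_add_one hN (j + ((-n - 1 : ℤ) : ZMod N))
    rw [show j + ((-n - 1 : ℤ) : ZMod N) + 1 = j + ((-n : ℤ) : ZMod N) by push_cast; ring, ih] at h
    rw [zpow_sub₀ (by norm_num), zpow_one]
    linear_combination h

theorem alternating_zero (N : ℕ) : alternating N 0 = 1 := by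
  simp [alternating]

theorem G_pi (D : DDO s) :
    D.G π = ∑ k ∈ Finset.Ico (-(s.l : ℤ)) s.r, (D.α k : ℂ) * (-1) ^ k := by
  simp only [G, exp_I_mul_int_mul_pi]

/-- The roots of the characteristic equation at `θ = π` give eigenvalues of the semi-discretized
system with an even number of cells. -/
theorem hasEigenvalue_semiDiscrete (D : DDO s) {N : ℕ} (hN0 : 0 < N) (hN : Even N) {z : ℂ}
    (hz : z ^ 2 - D.H π * z - D.F π = 0) : (D.semiDiscrete N).HasEigenvalue (-(N * z)) := by
  have : NeZero N := ⟨hN0.ne'⟩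
  -- An alternating function has forward difference `-2` times itself, so the cell equation with
  -- eigenvalue `-N z` forces the nodal amplitude `-z / 2`. The nodal equation is then the
  -- characteristic equation at `π`.
  refine Module.End.hasEigenvalue_of_hasEigenvector
    (x := (fun j => alternating N j, fun j => -(z / 2) * alternating N j)) ⟨?_, ?_⟩
  · rw [Module.End.mem_eigenspace_iff]
    refine Prod.ext (funext fun j => ?_) (funext fun j => ?_)
    · simp only [semiDiscrete, LinearMap.coe_mk, AddHom.coe_mk, alternating_add_one hN,
        Prod.smul_fst, Pi.smul_apply, smul_eq_mul, one_div_one_div]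
      ring
    · simp only [semiDiscrete, LinearMap.coe_mk, AddHom.coe_mk, alternating_add_intCast hN,
        Prod.smul_snd, Pi.smul_apply, smul_eq_mul, one_div_one_div]
      have h1 : ∑ k ∈ Finset.Ico (-(s.l : ℤ)) s.r, (D.α k : ℂ) * ((-1) ^ k * alternating N j) =
          D.G π * alternating N j := by
        rw [G_pi, Finset.sum_mul]
        exact Finset.sum_congr rfl fun _ _ => by ring
      have h2 : ∑ k ∈ Finset.Icc (-(s.l' : ℤ)) s.r',
          (D.β k : ℂ) * (-(z / 2) * ((-1) ^ k * alternating N j)) =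
          -(z / 2) * D.H π * alternating N j := by
        rw [H_pi, Finset.mul_sum, Finset.sum_mul]
        exact Finset.sum_congr rfl fun _ _ => by ring
      rw [h1, h2]
      rw [F_pi] at hz
      linear_combination -(N : ℂ) * alternating N j / 2 * hz
  · intro h
    have := congrFun (congrArg Prod.fst h) 0
    simp [alternating_zero] at this

end HV.DDO

end

theorem theorem2 (s : HV.Stencil) (hs : s.IsContiguous) (h4 : s.R + 4 ≤ s.L) (h7 : s.L ≤ s.R + 7)
    (D : HV.DDO s) (hD : D.IsOptimal) :
    (D.H Real.pi).re < 0 ∧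
      ¬ D.IsVonNeumannStable ∧
      ∀ N : ℕ, 0 < N → Even N → ¬ D.IsStableWith N := by
  have hneg : (D.H Real.pi).re < 0 := by
    have h : D.H Real.pi = ((∑ k ∈ Finset.Icc (-(s.l' : ℤ)) s.r', D.β k * (-1) ^ k : ℝ) : ℂ) := by
      rw [HV.DDO.H_pi]; push_cast; rfl
    rw [h, Complex.ofReal_re]
    exact hD.alternating_sum_neg hs h4 h7
  obtain ⟨z, hz, hroot⟩ := HV.DDO.exists_root_re_neg (c := D.F Real.pi) hneg
  refine ⟨hneg, fun hst => ?_, fun N hN0 hN hst => ?_⟩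
  · have : 0 < z.re := hst ⟨Real.pi, Real.pi_pos, by linarith [Real.pi_pos], hroot⟩
    linarith
  · have hre : 0 < (-((N : ℂ) * z)).re := by
      have : (0 : ℝ) < N := by exact_mod_cast hN0
      simp
      nlinarith
    rcases hst _ (D.hasEigenvalue_semiDiscrete hN0 hN hroot) with h | ⟨h, -⟩
    · linarith
    · rw [h] at hre; simp at hre
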